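/- **Setting.** Let $G=(\mathcal V,\mathcal E)$ be a finite simple undirected graph, let $K,M$ be integers, and let every edge $e\in\mathcal E$ carry a label $f(e)\subseteq[K]$ that is either empty or of size $M$. A *secure storage code* over $G$ consists of a finite field $\mathbb F_q$, lengths $L\ge 1$ and $L_Z\ge 0$, and, for every node $V$, a coded symbol (also written $V$) that is a deterministic function, with values in a finite set, of $K$ source symbols $W_1,\dots,W_K\in\mathbb F_q^L$ and a source key $\mathcal Z\in\mathbb F_q^{L_Z}$, all independent and uniform, such that for every edge $\{V_i,V_j\}$ with label $\mathcal M$ $$H\big(\{W_k\}_{k\in\mathcal M}\mid V_i,V_j\big)=0,\qquad I\big(V_i,V_j;\{W_k\}_{k\in[K]\setminus\mathcal M}\mid\{W_k\}_{k\in\mathcal M}\big)=0 .$$ Its source key rate is $L/L_Z$ (which is $\infty$ if $L_Z=0$). The *source key capacity* $C$ of $G$ is the supremum of all achievable rates, that is, of the rates of codes and of their limits along sequences of codes with $L\to\infty$. For a node $V$ let $\mathcal C(V)$ be the intersection of the labels of all edges incident to $V$. The node $V$ is *degenerate* if all edges incident to it have the same label. The *non-degenerate subgraph* $\widetilde G$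 is the labelled subgraph of $G$ induced on the non-degenerate nodes. An edge is *qualified* if its label is nonempty, and *unqualified* otherwise. Let $G^{*}$ be the labelled subgraph of $\widetilde G$ induced on those nodes of $\widetilde G$ that are incident to at least one qualified edge of $\widetilde G$. (If $G$ has no degenerate nodes, then $G^{*}=\widetilde G=G$.) For a labelled graph $H$ and $k\in[K]$, the *characteristic graph* $H^{[k]}$ has the nodes and edges of $H$, and an edge $e$ has in it the label $\{k\}$ if $k\in f(e)$, and $\emptyset$ otherwise. A qualified edge of a labelled graph is *internal* if its two endpoints are connected by a path of unqualified edges. **Theorem.** Suppose that $G^{*}$ is nonempty and that $\mathcal C(V)=\emptyset$ for every non-degenerate node $V$ of $G$. Then $C=1/M$ if and only if, for every $k\in[K]$, the characteristic graph $(G^{*})^{[k]}$ contains no internal qualified edge. -/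

import Mathlib

/-!
Secure storage codes over labelled graphs.
-/

section Entropy

/-- Shannon entropy, with logarithms to base `b`, of a random variable `X` on a finite sample
space `Ω` that carries the uniform distribution. -/
noncomputable def entropy (b : ℕ) {Ω A : Type} [Fintype Ω] [Fintype A] (X : Ω → A) : ℝ :=
  ∑ a : A, Real.negMulLog ((Nat.card {ω : Ω // X ω = a} : ℝ) / (Fintype.card Ω : ℝ)) /
    Real.log (b : ℝ)

/-- Conditional entropy `H(X | Y) = H(X, Y) - H(Y)`. -/
noncomputable def condEntropy (b : ℕ) {Ω A B : Type} [Fintype Ω] [Fintype A] [Fintype B]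
    (X : Ω → A) (Y : Ω → B) : ℝ :=
  entropy b (fun ω => (X ω, Y ω)) - entropy b Y

/-- Conditional mutual information `I(X; Y | T) = H(X | T) - H(X | Y, T)`. -/
noncomputable def condMutualInfo (b : ℕ) {Ω A B C : Type} [Fintype Ω] [Fintype A] [Fintype B]
    [Fintype C] (X : Ω → A) (Y : Ω → B) (T : Ω → C) : ℝ :=
  condEntropy b X T - condEntropy b X (fun ω => (Y ω, T ω))

end Entropy

/-- A graph on the node set `V` whose edges are labelled by sets of source symbols (indexed by
`Fin K`), each label being empty or of size `M`. Labels of non-edges play no role. -/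
structure StorageGraph (V : Type*) (K M : ℕ) where
  graph : SimpleGraph V
  label : Sym2 V → Finset (Fin K)
  label_card : ∀ e ∈ graph.edgeSet, label e = ∅ ∨ (label e).card = M

namespace StorageGraph

variable {V : Type*} {K M : ℕ}

/-- A qualified edge: an edge with nonempty label. -/
def IsQualified (G : StorageGraph V K M) (e : Sym2 V) : Prop :=
  e ∈ G.graph.edgeSet ∧ G.label e ≠ ∅

/-- The graph formed by the unqualified edges (those with empty label). -/
def unqualifiedGraph (G : StorageGraph V K M) : SimpleGraph V where
  Adj u v := G.graph.Adj u v ∧ G.label s(u, v) = ∅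
  symm := ⟨fun u v h => ⟨h.1.symm, by rw [Sym2.eq_swap]; exact h.2⟩⟩
  loopless := ⟨fun _ h => h.1.ne rfl⟩

/-- Some qualified edge is internal: its endpoints are connected by an unqualified path. -/
def HasInternalQualifiedEdge (G : StorageGraph V K M) : Prop :=
  ∃ u v : V, G.IsQualified s(u, v) ∧ G.unqualifiedGraph.Reachable u v

/-- The characteristic graph of the source symbol `k`: the same nodes and edges, each edge being
labelled by `{k}` or by `∅`. -/
def charGraph (G : StorageGraph V K M) (k : Fin K) : StorageGraph V K 1 where
  graph := G.graph
  label e := if k ∈ G.label e then {k} else ∅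
  label_card e _ := by
    by_cases h : k ∈ G.label e <;> simp [h]

/-- The common sources of a node: the intersection of the labels of all incident edges. -/
noncomputable def commonSources (G : StorageGraph V K M) (v : V) : Finset (Fin K) :=
  open Classical in
  Finset.univ.filter fun k => ∀ u, G.graph.Adj v u → k ∈ G.label s(v, u)

/-- A degenerate node: all incident edges carry the same label. -/
def IsDegenerate (G : StorageGraph V K M) (v : V) : Prop :=
  ∀ u, G.graph.Adj v u → G.label s(v, u) = G.commonSources v

/-- The labelled subgraph induced on a set of nodes. -/
def induce (G : StorageGraph V K M) (s : Set V) : StorageGraph s K M where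
  graph := G.graph.induce s
  label e := G.label (e.map Subtype.val)
  label_card e he := by
    induction e using Sym2.ind with
    | _ u v => exact G.label_card s(u.1, v.1) he

/-- The non-degenerate subgraph. -/
def nonDegenerateSubgraph (G : StorageGraph V K M) :
    StorageGraph {v : V | ¬ G.IsDegenerate v} K M :=
  G.induce {v : V | ¬ G.IsDegenerate v}

/-- The nodes of a labelled graph that are incident to at least one qualified edge. -/
def qualifiedNodes (G : StorageGraph V K M) : Set V :=
  {v : V | ∃ u, G.IsQualified s(v, u)}

/-- The core: the part of the non-degenerate subgraph induced on those of its nodes that are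
incident to a qualified edge of the non-degenerate subgraph. It is the whole graph if there are
no degenerate nodes. -/
def core (G : StorageGraph V K M) : StorageGraph G.nonDegenerateSubgraph.qualifiedNodes K M :=
  G.nonDegenerateSubgraph.induce G.nonDegenerateSubgraph.qualifiedNodes

end StorageGraph

/-- The sample space: `K` source symbols of `L` field symbols each and a key of `LZ` field
symbols. Under the uniform distribution all of them are independent and uniform over `F`. -/
abbrev SourceSpace (F : Type) (K L LZ : ℕ) : Type :=
  (Fin K → Fin L → F) × (Fin LZ → F)

/-- The random variable consisting of the source symbols with index in `S`. -/
def sources {F : Type} {K L LZ : ℕ} (S : Finset (Fin K)) (ω : SourceSpace F K L LZ) :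
    S → Fin L → F :=
  fun k => ω.1 k

/-- A secure storage code over `G`: a finite field, a source length, a key length, and for each
node a coded symbol that is a function of the sources and the key, such that every edge reveals
the sources in its label (correctness), and nothing more about the sources (security). -/
structure SecureStorageCode {V : Type*} {K M : ℕ} (G : StorageGraph V K M) where
  F : Type
  [field : Field F]
  [fintypeField : Fintype F]
  L : ℕ
  LZ : ℕ
  L_pos : 0 < L
  Alphabet : V → Type
  [fintypeAlphabet : ∀ v, Fintype (Alphabet v)]
  enc : ∀ v, SourceSpace F K L LZ → Alphabet v
  correctness : ∀ u v, G.graph.Adj u v →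
    condEntropy (Fintype.card F) (sources (G.label s(u, v))) (fun ω => (enc u ω, enc v ω)) = 0
  security : ∀ u v, G.graph.Adj u v →
    condMutualInfo (Fintype.card F) (fun ω => (enc u ω, enc v ω))
      (sources (G.label s(u, v))ᶜ) (sources (G.label s(u, v))) = 0

namespace SecureStorageCode

variable {V : Type*} {K M : ℕ} {G : StorageGraph V K M}

/-- The source key rate `L / LZ`, which is `∞` for a code without key. -/
noncomputable def rate (c : SecureStorageCode G) : ENNReal :=
  (c.L : ENNReal) / (c.LZ : ENNReal)

end SecureStorageCode

namespace StorageGraph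

variable {V : Type*} {K M : ℕ}

/-- A rate is achievable if it is the rate of a code, or the limit of the rates of a sequence of
codes whose source lengths tend to infinity. -/
def IsAchievable (G : StorageGraph V K M) (R : ENNReal) : Prop :=
  (∃ c : SecureStorageCode G, c.rate = R) ∨
    ∃ c : ℕ → SecureStorageCode G,
      Filter.Tendsto (fun n => (c n).L) Filter.atTop Filter.atTop ∧
      Filter.Tendsto (fun n => (c n).rate) Filter.atTop (nhds R)

/-- The source key capacity: the supremum of all achievable source key rates. -/
noncomputable def sourceKeyCapacity (G : StorageGraph V K M) : ENNReal :=
  sSup {R | G.IsAchievable R}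

end StorageGraph

/-! Since the sample space is finite and uniform, the entropy conditions become counting statements.
Correctness says that the two symbols of an edge determine the sources in its label. Security says
that the number of keys producing a given pair of symbols depends only on those sources
(`condEntropy_eq_zero_iff`, `condMutualInfo_sources_eq_zero_iff`).

Converse. Write q for the field size. The symbol of a node without common sources is independent of
the sources. On a qualified edge between two such nodes, decoding then forces each value of a symbol
to arise from at most q^(LZ - M L) keys (`encCard_le`); in particular M L ≤ LZ, so the rate is at
most 1/M. Suppose a qualified edge uv of the characteristic graph of k is internal, through a path
of n edges. Fix the symbol at u and let only source k vary. Along an edge whose label omits k,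
security allows at most q^(LZ - M L) values at the next node for each value at the current one, so v
takes at most q^(n (LZ - M L)) values. Decoding source k requires at least q^L. Thus L ≤ n (LZ - M
L), and every rate is at most n/(n M + 1) < 1/M.

Achievability. Without internal edges a linear code with L = 1 and LZ = M works. For each k, colour
the core nodes by their component in the unqualified part of the characteristic graph. A core node
stores the key plus a Vandermonde combination of the sources, source k being scaled by its colour.
Subtracting the symbols of adjacent core nodes cancels the key and every source outside the label,
while the sources in the label keep nonzero coefficients and are recovered by Vandermonde
invertibility. Degenerate nodes store their common sources in the clear and need no key. -/

/-- The number of points of `Ω` at which `X` takes the value `a`. -/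
noncomputable def fiberCard {Ω A : Type} (X : Ω → A) (a : A) : ℕ :=
  Nat.card {ω : Ω // X ω = a}

/-! ### Counting fibres of random variables. -/

section FiberCard

variable {Ω A B C : Type} [Fintype Ω]

lemma fiberCard_eq_sum [Fintype B] {X : Ω → A} {Y : Ω → C} (Z : Ω → B) (e : B → C) {a : A}
    (h : ∀ ω b, Y ω = e b ↔ X ω = a ∧ Z ω = b) :
    fiberCard X a = ∑ b, fiberCard Y (e b) := by
  classical
  simp only [fiberCard, Nat.card_eq_fintype_card, Fintype.card_subtype, h]
  rw [Finset.card_eq_sum_card_fiberwise (f := Z) (t := Finset.univ) (by simp)]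
  simp [Finset.filter_filter]

lemma fiberCard_pos_iff {X : Ω → A} {a : A} : 0 < fiberCard X a ↔ ∃ ω, X ω = a := by
  simp [fiberCard, Nat.card_pos_iff, nonempty_subtype]
  intro _ _
  infer_instance

lemma fiberCard_le_of_imp {X : Ω → A} {Y : Ω → B} {a : A} {b : B}
    (h : ∀ ω, X ω = a → Y ω = b) : fiberCard X a ≤ fiberCard Y b :=
  Nat.card_le_card_of_injective (fun ω : {ω // X ω = a} => (⟨ω.1, h _ ω.2⟩ : {ω // Y ω = b}))
    fun ω₁ ω₂ h => Subtype.ext (by simpa using h)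

end FiberCard

/-! ### Vanishing entropy quantities as counting conditions. -/

section Entropy

open Real

/-- The gap in Gibbs' inequality for one cell of a joint distribution. -/
lemma gibbs_cell {p s t u : ℝ} (hp : 0 ≤ p) (hs : p ≤ s) (ht : p ≤ t) (hsu : s ≤ u) :
    0 ≤ p * (log p + log u - log s - log t) - p + s * t / u ∧
      (p * (log p + log u - log s - log t) - p + s * t / u = 0 ↔ p * u = s * t) := by
  rcases hp.eq_or_lt with rfl | hp
  · refine ⟨by have := hs.trans hsu; simp; positivity, ?_⟩
    rcases (hs.trans hsu).eq_or_lt with rfl | hu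
    · have : s = 0 := le_antisymm hsu hs
      simp [this]
    · simp [hu.ne', eq_comm]
  · have hs' := hp.trans_le hs
    have ht' := hp.trans_le ht
    have hu' := hs'.trans_le hsu
    set r := s * t / u with hr
    have hr' : 0 < r := by positivity
    -- The gap is p (r/p - 1 - log (r/p)), so everything reduces to log x ≤ x - 1, with equality
    -- only at x = 1.
    have hlog : log p + log u - log s - log t = - log (r / p) := by
      rw [hr, log_div (by positivity) hp.ne', log_div (by positivity) hu'.ne',
        log_mul hs'.ne' ht'.ne']
      ring
    have hrp : r / p * p = r := by field_simp
    have key : p * (-log (r / p)) - p + r = p * (r / p - 1 - log (r / p)) := by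
      nlinarith
    rw [hlog, key]
    have hle := log_le_sub_one_of_pos (div_pos hr' hp)
    refine ⟨mul_nonneg hp.le (by linarith), ?_⟩
    have h1 : p * u = s * t ↔ r / p = 1 := by
      rw [hr, div_eq_one_iff_eq hp.ne', div_eq_iff hu'.ne', eq_comm]
    rw [h1, mul_eq_zero, or_iff_right hp.ne']
    constructor
    · intro h
      by_contra hne
      have := log_lt_sub_one_of_pos (div_pos hr' hp) hne
      linarith
    · intro h
      simp [h]

/-- The corrections -p and s t / u both have total mass ∑ u and cancel. They make each cell
nonnegative without changing the sum, which is the conditional mutual information up to the factor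
log b. -/
lemma sum_gibbs_cell {A B C : Type} [Fintype A] [Fintype B] [Fintype C] {p : A → B → C → ℝ}
    {s : A → C → ℝ} {t : B → C → ℝ} {u : C → ℝ} (hs : ∀ a c, s a c = ∑ b, p a b c)
    (ht : ∀ b c, t b c = ∑ a, p a b c) (hu : ∀ c, u c = ∑ b, t b c) :
    ∑ a, ∑ b, ∑ c, (p a b c * (log (p a b c) + log (u c) - log (s a c) - log (t b c)) - p a b c
        + s a c * t b c / u c) =
      ∑ a, ∑ c, negMulLog (s a c) - ∑ c, negMulLog (u c) - ∑ a, ∑ b, ∑ c, negMulLog (p a b c)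
        + ∑ b, ∑ c, negMulLog (t b c) := by
  have hrot : ∀ f : A → B → C → ℝ, ∑ a, ∑ b, ∑ c, f a b c = ∑ c, ∑ a, ∑ b, f a b c := fun f => by
    rw [Finset.sum_comm (s := (Finset.univ : Finset C))]
    exact Finset.sum_congr rfl fun a _ => Finset.sum_comm
  have hu' : ∀ c, u c = ∑ a, s a c := fun c => by
    simp only [hu, hs, ht]
    exact Finset.sum_comm
  have h1 : ∑ a, ∑ c, negMulLog (s a c) = -∑ a, ∑ b, ∑ c, p a b c * log (s a c) := by
    simp only [← Finset.sum_neg_distrib]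
    refine Finset.sum_congr rfl fun a _ => ?_
    rw [Finset.sum_comm]
    refine Finset.sum_congr rfl fun c _ => ?_
    rw [Finset.sum_neg_distrib, ← Finset.sum_mul, ← hs, negMulLog, neg_mul]
  have h2 : ∑ b, ∑ c, negMulLog (t b c) = -∑ a, ∑ b, ∑ c, p a b c * log (t b c) := by
    rw [Finset.sum_comm (s := (Finset.univ : Finset A))]
    simp only [← Finset.sum_neg_distrib]
    refine Finset.sum_congr rfl fun b _ => ?_
    rw [Finset.sum_comm (s := (Finset.univ : Finset A))]
    refine Finset.sum_congr rfl fun c _ => ?_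
    rw [Finset.sum_neg_distrib, ← Finset.sum_mul, ← ht, negMulLog, neg_mul]
  have h3 : ∑ c, negMulLog (u c) = -∑ a, ∑ b, ∑ c, p a b c * log (u c) := by
    have : ∀ c, negMulLog (u c) = -∑ a, ∑ b, p a b c * log (u c) := fun c => by
      simp only [← Finset.sum_mul, ← hs, ← hu', negMulLog, neg_mul]
    simp only [this, Finset.sum_neg_distrib]
    rw [hrot]
  have h4 : ∑ a, ∑ b, ∑ c, p a b c = ∑ c, u c := by
    simp only [hu', hs]
    rw [hrot]
  have h5 : ∑ a, ∑ b, ∑ c, s a c * t b c / u c = ∑ c, u c := by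
    have : ∀ c, ∑ a, ∑ b, s a c * t b c / u c = u c := fun c => by
      simp only [← Finset.sum_div, ← Finset.mul_sum, ← Finset.sum_mul, ← hu, ← hu']
      rcases eq_or_ne (u c) 0 with h | h
      · simp [h]
      · field_simp
    rw [hrot]
    exact Finset.sum_congr rfl fun c _ => this c
  have h6 : ∑ a, ∑ b, ∑ c, negMulLog (p a b c) =
      -∑ a, ∑ b, ∑ c, p a b c * log (p a b c) := by
    simp only [← Finset.sum_neg_distrib, negMulLog, neg_mul]
  rw [h1, h2, h3, h6]
  simp only [Finset.sum_add_distrib, Finset.sum_sub_distrib, mul_add, mul_sub]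
  rw [h4, h5]
  ring

variable {Ω A B C : Type} [Fintype Ω] [Fintype A] [Fintype B] [Fintype C]

lemma entropy_eq (b : ℕ) (X : Ω → A) :
    entropy b X = (∑ a, negMulLog ((fiberCard X a : ℝ) / Fintype.card Ω)) / log b := by
  rw [entropy, Finset.sum_div]
  rfl

/-- Conditional mutual information vanishes exactly under conditional independence. -/
theorem condMutualInfo_eq_zero_iff [Nonempty Ω] {b : ℕ} (hb : 1 < b) (X : Ω → A) (Y : Ω → B)
    (T : Ω → C) :
    condMutualInfo b X Y T = 0 ↔ ∀ x y t,
      fiberCard (fun ω => (X ω, (Y ω, T ω))) (x, (y, t)) * fiberCard T t =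
        fiberCard (fun ω => (X ω, T ω)) (x, t) * fiberCard (fun ω => (Y ω, T ω)) (y, t) := by
  have hn : (0 : ℝ) < Fintype.card Ω := by exact_mod_cast Fintype.card_pos
  set n : ℝ := (Fintype.card Ω : ℝ) with hndef
  let p : A → B → C → ℝ := fun x y t => fiberCard (fun ω => (X ω, (Y ω, T ω))) (x, (y, t)) / n
  let s : A → C → ℝ := fun x t => fiberCard (fun ω => (X ω, T ω)) (x, t) / n
  let v : B → C → ℝ := fun y t => fiberCard (fun ω => (Y ω, T ω)) (y, t) / n
  let u : C → ℝ := fun t => fiberCard T t / n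
  have hs : ∀ a c, s a c = ∑ b, p a b c := fun a c => by
    simp only [s, p, ← Finset.sum_div]
    rw [fiberCard_eq_sum (Y := fun ω => (X ω, (Y ω, T ω))) Y (fun b => (a, (b, c)))
      (by intro ω b; simp only [Prod.mk.injEq]; tauto)]
    push_cast; rfl
  have hv : ∀ b c, v b c = ∑ a, p a b c := fun b c => by
    simp only [v, p, ← Finset.sum_div]
    rw [fiberCard_eq_sum (Y := fun ω => (X ω, (Y ω, T ω))) X (fun a => (a, (b, c)))
      (by intro ω b; simp only [Prod.mk.injEq]; tauto)]
    push_cast; rfl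
  have hu : ∀ c, u c = ∑ b, v b c := fun c => by
    simp only [u, v, ← Finset.sum_div]
    rw [fiberCard_eq_sum (Y := fun ω => (Y ω, T ω)) Y (fun b => (b, c))
      (by intro ω b; simp only [Prod.mk.injEq]; tauto)]
    push_cast; rfl
  have hp : ∀ a b c, 0 ≤ p a b c := fun a b c => by positivity
  have hps : ∀ a b c, p a b c ≤ s a c := fun a b c => by
    rw [hs]
    exact Finset.single_le_sum (f := fun b => p a b c) (fun b _ => hp a b c) (Finset.mem_univ b)
  have hpv : ∀ a b c, p a b c ≤ v b c := fun a b c => by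
    rw [hv]
    exact Finset.single_le_sum (f := fun a => p a b c) (fun a _ => hp a b c) (Finset.mem_univ a)
  have hsu : ∀ a c, s a c ≤ u c := fun a c => by
    rw [hu, hs]
    exact Finset.sum_le_sum fun b _ => hpv a b c
  have hlog : 0 < log b := log_pos (by exact_mod_cast hb)
  have hI : condMutualInfo b X Y T =
      (∑ a, ∑ b, ∑ c, (p a b c * (log (p a b c) + log (u c) - log (s a c) - log (v b c)) - p a b c
        + s a c * v b c / u c)) / log b := by
    rw [sum_gibbs_cell hs hv hu]
    simp only [condMutualInfo, condEntropy, entropy_eq, Fintype.sum_prod_type]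
    rw [← hndef]
    ring
  have hcell := fun a b c => gibbs_cell (hp a b c) (hps a b c) (hpv a b c) (hsu a c)
  rw [hI, div_eq_zero_iff, or_iff_left hlog.ne',
    Finset.sum_eq_zero_iff_of_nonneg fun a _ => Finset.sum_nonneg fun b _ =>
      Finset.sum_nonneg fun c _ => (hcell a b c).1]
  refine forall_congr' fun a => ?_
  rw [imp_iff_right (Finset.mem_univ _), Finset.sum_eq_zero_iff_of_nonneg fun b _ =>
      Finset.sum_nonneg fun c _ => (hcell a b c).1]
  refine forall_congr' fun b => ?_
  rw [imp_iff_right (Finset.mem_univ _), Finset.sum_eq_zero_iff_of_nonneg fun c _ =>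
      (hcell a b c).1]
  refine forall_congr' fun c => ?_
  rw [imp_iff_right (Finset.mem_univ _), (hcell a b c).2, ← @Nat.cast_inj ℝ]
  simp only [p, s, u, v]
  push_cast
  field_simp

/-- Conditional entropy vanishes exactly when `X` is a function of `Y`. -/
theorem condEntropy_eq_zero_iff [Nonempty Ω] {b : ℕ} (hb : 1 < b) (X : Ω → A) (Y : Ω → B) :
    condEntropy b X Y = 0 ↔ ∀ ω ω', Y ω = Y ω' → X ω = X ω' := by
  have hn : (0 : ℝ) < Fintype.card Ω := by exact_mod_cast Fintype.card_pos
  set n : ℝ := (Fintype.card Ω : ℝ) with hndef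
  let p : A → B → ℝ := fun x y => fiberCard (fun ω => (X ω, Y ω)) (x, y) / n
  let u : B → ℝ := fun y => fiberCard Y y / n
  have hu : ∀ y, u y = ∑ x, p x y := fun y => by
    simp only [u, p, ← Finset.sum_div]
    rw [fiberCard_eq_sum (Y := fun ω => (X ω, Y ω)) X (fun x => (x, y))
      (by intro ω b; simp only [Prod.mk.injEq]; tauto)]
    push_cast; rfl
  have hp : ∀ x y, 0 ≤ p x y := fun x y => by positivity
  have hpu : ∀ x y, p x y ≤ u y := fun x y => by
    rw [hu]
    exact Finset.single_le_sum (f := fun x => p x y) (fun x _ => hp x y) (Finset.mem_univ x)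
  have hlog : 0 < log b := log_pos (by exact_mod_cast hb)
  have hH : condEntropy b X Y = (∑ x, ∑ y, p x y * (log (u y) - log (p x y))) / log b := by
    have h1 : ∑ y, negMulLog (u y) = -∑ x, ∑ y, p x y * log (u y) := by
      rw [Finset.sum_comm, ← Finset.sum_neg_distrib]
      refine Finset.sum_congr rfl fun y _ => ?_
      rw [← Finset.sum_mul, ← hu, negMulLog, neg_mul]
    have h2 : ∑ x, ∑ y, negMulLog (p x y) = -∑ x, ∑ y, p x y * log (p x y) := by
      simp only [← Finset.sum_neg_distrib, negMulLog, neg_mul]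
    simp only [condEntropy, entropy_eq, Fintype.sum_prod_type]
    rw [← hndef]
    change (∑ x, ∑ y, negMulLog (p x y)) / log b - (∑ y, negMulLog (u y)) / log b = _
    rw [h1, h2]
    simp only [mul_sub, Finset.sum_sub_distrib]
    ring
  have hcell : ∀ x y, 0 ≤ p x y * (log (u y) - log (p x y)) := fun x y => by
    rcases (hp x y).eq_or_lt with h | h
    · simp [← h]
    · exact mul_nonneg h.le (sub_nonneg.2 (log_le_log h (hpu x y)))
  rw [hH, div_eq_zero_iff, or_iff_left hlog.ne',
    Finset.sum_eq_zero_iff_of_nonneg fun x _ => Finset.sum_nonneg fun y _ => hcell x y]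
  have hpeq : ∀ x y, p x y = u y ↔ ∀ ω, Y ω = y → X ω = x := fun x y => by
    classical
    simp only [p, u, div_left_inj' hn.ne', Nat.cast_inj, fiberCard, Nat.card_eq_fintype_card,
      Fintype.card_subtype]
    constructor
    · intro h ω hω
      have := Finset.eq_of_subset_of_card_le (s := {ω | (X ω, Y ω) = (x, y)})
        (t := {ω | Y ω = y}) (fun ω hω => by simp_all) h.ge
      have h' : ω ∈ ({ω | (X ω, Y ω) = (x, y)} : Finset Ω) := by rw [this]; simpa using hω
      exact (by simpa using h' : X ω = x ∧ Y ω = y).1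
    · intro h
      congr 1
      ext ω
      simpa using h ω
  have hpos : ∀ ω, 0 < p (X ω) (Y ω) := fun ω =>
    div_pos (by exact_mod_cast fiberCard_pos_iff.2 ⟨ω, rfl⟩) hn
  constructor
  · intro h ω ω' hY
    have h1 := (Finset.sum_eq_zero_iff_of_nonneg fun y _ => hcell (X ω) y).1
      (h (X ω) (Finset.mem_univ _)) (Y ω) (Finset.mem_univ _)
    rw [mul_eq_zero, or_iff_right (hpos ω).ne', sub_eq_zero] at h1
    have h2 := log_injOn_pos ((hpos ω).trans_le (hpu _ _)) (hpos ω) h1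
    exact ((hpeq _ _).1 h2.symm ω' hY.symm).symm
  · intro h x _
    refine Finset.sum_eq_zero fun y _ => ?_
    rcases (hp x y).eq_or_lt with h0 | h0
    · simp [← h0]
    · obtain ⟨ω, hω⟩ := fiberCard_pos_iff.1 (show 0 < fiberCard (fun ω => (X ω, Y ω)) (x, y) by
        by_contra hc
        simp [p, Nat.eq_zero_of_not_pos hc] at h0)
      simp only [Prod.mk.injEq] at hω
      rw [(hpeq x y).2 fun ω' hω' => (h _ _ (hω'.trans hω.2.symm)).trans hω.1]
      simp

end Entropy

/-! ### Security as invariance of key counts. -/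

section Sources

variable {F : Type} [Fintype F] {K L LZ : ℕ} {A : Type}

/-- A random variable carries no information on the sources outside `S` given those in `S`
exactly when its distribution given the sources depends only on those in `S`. -/
theorem condMutualInfo_sources_eq_zero_iff [Fintype A] [Nontrivial F]
    (X : SourceSpace F K L LZ → A) (S : Finset (Fin K)) :
    condMutualInfo (Fintype.card F) X (sources Sᶜ) (sources S) = 0 ↔
      ∀ x w w', (∀ k ∈ S, w k = w' k) →
        fiberCard (fun z => X (w, z)) x = fiberCard (fun z => X (w', z)) x := by
  classical
  rw [condMutualInfo_eq_zero_iff Fintype.one_lt_card]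
  have hsplit : ∀ (ω : SourceSpace F K L LZ) w,
      (sources Sᶜ ω = fun k => w k) ∧ (sources S ω = fun k => w k) ↔ ω.1 = w := by
    intro ω w
    constructor
    · rintro ⟨h1, h2⟩
      funext k
      by_cases hk : k ∈ S
      · exact congrFun h2 ⟨k, hk⟩
      · exact congrFun h1 ⟨k, by simpa using hk⟩
    · rintro rfl
      exact ⟨rfl, rfl⟩
  have hYT : ∀ w : Fin K → Fin L → F,
      fiberCard (fun ω : SourceSpace F K L LZ => (sources Sᶜ ω, sources S ω))
        (fun k => w k, fun k => w k) = Nat.card (Fin LZ → F) := by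
    intro w
    refine Nat.card_congr
      ⟨fun ω => ω.1.2, fun z => ⟨(w, z), rfl⟩, fun ω => ?_, fun z => rfl⟩
    obtain ⟨⟨w', z⟩, h⟩ := ω
    rw [Prod.mk.injEq, hsplit] at h
    subst h
    rfl
  have hXYT : ∀ x (w : Fin K → Fin L → F),
      fiberCard (fun ω : SourceSpace F K L LZ => (X ω, (sources Sᶜ ω, sources S ω)))
        (x, (fun k => w k, fun k => w k)) = fiberCard (fun z => X (w, z)) x := by
    intro x w
    refine Nat.card_congr
      ⟨fun ω => ⟨ω.1.2, ?_⟩, fun z => ⟨(w, z.1), Prod.ext z.2 rfl⟩, fun ω => ?_, fun z => rfl⟩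
    · obtain ⟨⟨w', z⟩, h⟩ := ω
      rw [Prod.mk.injEq, Prod.mk.injEq, hsplit] at h
      obtain ⟨h1, h2⟩ := h
      subst h2
      exact h1
    · obtain ⟨⟨w', z⟩, h⟩ := ω
      rw [Prod.mk.injEq, Prod.mk.injEq, hsplit] at h
      obtain ⟨h1, h2⟩ := h
      subst h2
      rfl
  constructor
  · intro h x w w' hw
    have e : (fun k : S => w k) = fun k : S => w' k := funext fun k => hw k k.2
    have h1 := h x (fun k => w k) (fun k => w k)
    have h2 := h x (fun k => w' k) (fun k => w' k)
    rw [hXYT, hYT] at h1 h2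
    rw [e] at h1
    have hpos : 0 < fiberCard (sources (F := F) (L := L) (LZ := LZ) S) (fun k => w' k) :=
      fiberCard_pos_iff.2 ⟨(w', fun _ => Classical.arbitrary F), rfl⟩
    exact Nat.eq_of_mul_eq_mul_right hpos (h1.trans h2.symm)
  · intro h x y t
    -- Here `t` fixes the sources in `S` and `glue` completes it. By hypothesis the key count is the
    -- same for all completions, so summing over them just multiplies by their number.
    let glue : (↥Sᶜ → Fin L → F) → Fin K → Fin L → F := fun y k =>
      if hk : k ∈ S then t ⟨k, hk⟩ else y ⟨k, by simpa using hk⟩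
    have hg1 : ∀ y, (fun k : ↥Sᶜ => glue y k) = y := fun y => funext fun k => by
      simp [glue, Finset.mem_compl.1 k.2]
    have hg2 : ∀ y, (fun k : S => glue y k) = t := fun y => funext fun k => by
      simp [glue]
    have hYT' : ∀ y, fiberCard (fun ω : SourceSpace F K L LZ => (sources Sᶜ ω, sources S ω))
        (y, t) = Nat.card (Fin LZ → F) := fun y => by
      have := hYT (glue y)
      rwa [hg1, hg2] at this
    have hXYT' : ∀ y', fiberCard (fun ω : SourceSpace F K L LZ =>
        (X ω, (sources Sᶜ ω, sources S ω))) (x, (y', t)) =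
          fiberCard (fun z => X (glue y, z)) x := fun y' => by
      have := hXYT x (glue y')
      rw [hg1, hg2] at this
      rw [this]
      exact h _ _ _ fun k hk => by simp [glue, hk]
    rw [fiberCard_eq_sum (X := sources S)
        (Y := fun ω : SourceSpace F K L LZ => (sources Sᶜ ω, sources S ω)) (sources Sᶜ)
        (fun y => (y, t)) (by intro ω b; simp only [Prod.mk.injEq]; tauto),
      fiberCard_eq_sum (X := fun ω => (X ω, sources S ω))
        (Y := fun ω : SourceSpace F K L LZ => (X ω, (sources Sᶜ ω, sources S ω))) (sources Sᶜ)
        (fun y => (x, (y, t))) (by intro ω b; simp only [Prod.mk.injEq]; tauto)]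
    simp only [hYT', hXYT', Finset.sum_const, smul_eq_mul]
    ring

end Sources

/-! ### Key bound from a single qualified edge. -/

namespace SecureStorageCode

variable {V : Type*} {K M : ℕ} {G : StorageGraph V K M}

instance (c : SecureStorageCode G) : Field c.F := c.field

instance (c : SecureStorageCode G) : Fintype c.F := c.fintypeField

instance (c : SecureStorageCode G) (v : V) : Fintype (c.Alphabet v) := c.fintypeAlphabet v

variable (c : SecureStorageCode G)

/-- The number of keys for which the sources `w` are encoded as `x` at the node `v`. -/
noncomputable def encCard (v : V) (w : Fin K → Fin c.L → c.F) (x : c.Alphabet v) : ℕ :=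
  fiberCard (fun z => c.enc v (w, z)) x

/-- The number of keys for which the sources `w` are encoded as `x` at `u` and `y` at `v`. -/
noncomputable def encPairCard (u v : V) (w : Fin K → Fin c.L → c.F) (x : c.Alphabet u)
    (y : c.Alphabet v) : ℕ :=
  fiberCard (fun z => (c.enc u (w, z), c.enc v (w, z))) (x, y)

variable {c}

lemma decode {u v : V} (h : G.graph.Adj u v) {ω ω' : SourceSpace c.F K c.L c.LZ}
    (hu : c.enc u ω = c.enc u ω') (hv : c.enc v ω = c.enc v ω') {k : Fin K}
    (hk : k ∈ G.label s(u, v)) : ω.1 k = ω'.1 k := by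
  have := (condEntropy_eq_zero_iff Fintype.one_lt_card _ _).1 (c.correctness u v h) ω ω'
    (Prod.ext hu hv)
  exact congrFun this ⟨k, hk⟩

lemma encPairCard_congr {u v : V} (h : G.graph.Adj u v) {w w' : Fin K → Fin c.L → c.F}
    (hw : ∀ k ∈ G.label s(u, v), w k = w' k) (x : c.Alphabet u) (y : c.Alphabet v) :
    c.encPairCard u v w x y = c.encPairCard u v w' x y :=
  (condMutualInfo_sources_eq_zero_iff _ _).1 (c.security u v h) (x, y) w w' hw

lemma encCard_eq_sum (u v : V) (w : Fin K → Fin c.L → c.F) (x : c.Alphabet u) :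
    c.encCard u w x = ∑ y, c.encPairCard u v w x y :=
  fiberCard_eq_sum (fun z => c.enc v (w, z)) (fun y => (x, y)) fun _ _ => Prod.mk_inj

lemma encCard_congr {u v : V} (h : G.graph.Adj u v) {w w' : Fin K → Fin c.L → c.F}
    (hw : ∀ k ∈ G.label s(u, v), w k = w' k) (x : c.Alphabet u) :
    c.encCard u w x = c.encCard u w' x := by
  simp only [encCard_eq_sum u v, encPairCard_congr h hw]

lemma encPairCard_le (u v : V) (w : Fin K → Fin c.L → c.F) (x : c.Alphabet u)
    (y : c.Alphabet v) : c.encPairCard u v w x y ≤ c.encCard v w y :=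
  fiberCard_le_of_imp fun _ h => (Prod.mk_inj.1 h).2

lemma encPairCard_pos_iff {u v : V} {w : Fin K → Fin c.L → c.F} {x : c.Alphabet u}
    {y : c.Alphabet v} :
    0 < c.encPairCard u v w x y ↔ ∃ z, c.enc u (w, z) = x ∧ c.enc v (w, z) = y := by
  simp [encPairCard, fiberCard_pos_iff]

/-- The symbol of a node without common sources is independent of the sources. -/
theorem encCard_eq_of_commonSources_eq_empty {v : V} (hv : G.commonSources v = ∅)
    (w w' : Fin K → Fin c.L → c.F) (x : c.Alphabet v) : c.encCard v w x = c.encCard v w' x := by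
  classical
  -- Some edge at `v` omits `k` from its label, and security of that edge lets source `k` change
  -- freely. All sources are then changed one at a time.
  have hstep : ∀ (k : Fin K) (w : Fin K → Fin c.L → c.F) s,
      c.encCard v (Function.update w k s) x = c.encCard v w x := by
    intro k w s
    have hk : k ∉ G.commonSources v := by simp [hv]
    simp only [StorageGraph.commonSources, Finset.mem_filter, Finset.mem_univ, true_and,
      not_forall] at hk
    obtain ⟨u, hu, hk⟩ := hk
    refine encCard_congr hu (fun j hj => ?_) x
    rw [Function.update_of_ne]
    rintro rfl
    exact hk hj
  have : ∀ S : Finset (Fin K), c.encCard v (S.piecewise w' w) x = c.encCard v w x := by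
    intro S
    induction S using Finset.induction_on with
    | empty => simp
    | insert k S _ ih => rw [Finset.piecewise_insert, hstep, ih]
  rw [← this Finset.univ, Finset.piecewise_univ]

lemma sum_encCard (v : V) (w : Fin K → Fin c.L → c.F) :
    ∑ x, c.encCard v w x = Fintype.card c.F ^ c.LZ := by
  classical
  have := fiberCard_eq_sum (X := fun _ : Fin c.LZ → c.F => ()) (Y := fun z => c.enc v (w, z))
    (a := ()) (fun z => c.enc v (w, z)) id (by simp)
  simp only [encCard]
  simpa [fiberCard] using this.symm

/-- A qualified edge between nodes without common sources bounds the probability of each value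
of their symbols. -/
theorem encCard_mul_le {u v : V} (h : G.IsQualified s(u, v)) (hu : G.commonSources u = ∅)
    (hv : G.commonSources v = ∅) (w : Fin K → Fin c.L → c.F) (x : c.Alphabet u) :
    Fintype.card c.F ^ (M * c.L) * c.encCard u w x ≤ Fintype.card c.F ^ c.LZ := by
  classical
  have hadj : G.graph.Adj u v := h.1
  set S := G.label s(u, v) with hS
  have hcard : S.card = M := (G.label_card _ h.1).resolve_left h.2
  let W : (S → Fin c.L → c.F) → Fin K → Fin c.L → c.F := fun t k =>
    if hk : k ∈ S then t ⟨k, hk⟩ else 0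
  -- By decoding, at most one `t` can produce the pair `(x, y)`, and its count is at most that of
  -- `y` alone, which does not depend on the sources.
  have hle : ∀ y, ∑ t, c.encPairCard u v (W t) x y ≤ c.encCard v w y := by
    intro y
    by_cases hex : ∃ t, 0 < c.encPairCard u v (W t) x y
    · obtain ⟨t, ht⟩ := hex
      rw [Finset.sum_eq_single t]
      · exact (encPairCard_le u v _ x y).trans (encCard_eq_of_commonSources_eq_empty hv _ _ _).le
      · intro t' _ hne
        by_contra hpos
        obtain ⟨z, hz1, hz2⟩ := encPairCard_pos_iff.1 ht
        obtain ⟨z', hz1', hz2'⟩ := encPairCard_pos_iff.1 (Nat.pos_of_ne_zero hpos)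
        refine hne (funext fun k => ?_)
        have := decode hadj (hz1'.trans hz1.symm) (hz2'.trans hz2.symm) k.2
        simpa [W] using this
      · simp
    · push Not at hex
      rw [Finset.sum_eq_zero fun t _ => Nat.le_zero.1 (hex t)]
      exact Nat.zero_le _
  calc Fintype.card c.F ^ (M * c.L) * c.encCard u w x
      = ∑ t, c.encCard u (W t) x := by
        simp only [encCard_eq_of_commonSources_eq_empty hu _ w, Finset.sum_const, smul_eq_mul,
          Finset.card_univ]
        simp [hcard, ← pow_mul, mul_comm M]
    _ = ∑ y, ∑ t, c.encPairCard u v (W t) x y := by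
        simp only [encCard_eq_sum u v]
        exact Finset.sum_comm
    _ ≤ ∑ y, c.encCard v w y := Finset.sum_le_sum fun y _ => hle y
    _ = Fintype.card c.F ^ c.LZ := sum_encCard v w

theorem mul_L_le_LZ {u v : V} (h : G.IsQualified s(u, v)) (hu : G.commonSources u = ∅)
    (hv : G.commonSources v = ∅) : M * c.L ≤ c.LZ := by
  have hpos : 0 < c.encCard u 0 (c.enc u (0, 0)) := fiberCard_pos_iff.2 ⟨0, rfl⟩
  refine (Nat.pow_le_pow_iff_right (Fintype.one_lt_card (α := c.F))).1 ?_
  exact (Nat.le_mul_of_pos_right _ hpos).trans (encCard_mul_le h hu hv 0 _)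

theorem encCard_le {u v : V} (h : G.IsQualified s(u, v)) (hu : G.commonSources u = ∅)
    (hv : G.commonSources v = ∅) (w : Fin K → Fin c.L → c.F) (x : c.Alphabet u) :
    c.encCard u w x ≤ Fintype.card c.F ^ (c.LZ - M * c.L) := by
  have h1 := encCard_mul_le h hu hv w x
  rw [← Nat.add_sub_cancel' (mul_L_le_LZ (c := c) h hu hv), pow_add] at h1
  exact Nat.le_of_mul_le_mul_left h1 (pow_pos Fintype.card_pos _)

/-! ### Propagation along unqualified paths. -/

/-- The values of the symbol at `v` that are compatible with the value `x` at `u`, when all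
sources but the one with index `k` vanish. -/
def compatible (c : SecureStorageCode G) (k : Fin K) (u v : V) (x : c.Alphabet u) :
    Set (c.Alphabet v) :=
  {y | ∃ s z, c.enc u (Pi.single k s, z) = x ∧ c.enc v (Pi.single k s, z) = y}

/-- Security hides source `k` on this edge, so every compatible value already occurs with all
sources zero, under one of the keys that give `x` at `u`. -/
lemma ncard_compatible_le_of_adj {k : Fin K} {u v : V} (h : G.graph.Adj u v)
    (hk : k ∉ G.label s(u, v)) (x : c.Alphabet u) :
    (c.compatible k u v x).ncard ≤ c.encCard u 0 x := by
  classical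
  have hsub : c.compatible k u v x ⊆
      (fun z => c.enc v (0, z)) '' {z | c.enc u (0, z) = x} := by
    rintro y ⟨s, z, hz⟩
    have hpos := encPairCard_pos_iff.2 ⟨z, hz⟩
    rw [encPairCard_congr h (w' := 0) fun j hj => by
      rw [Pi.single_eq_of_ne (by rintro rfl; exact hk hj)]; rfl] at hpos
    obtain ⟨z', h1, h2⟩ := encPairCard_pos_iff.1 hpos
    exact ⟨z', h1, h2⟩
  refine (Set.ncard_le_ncard hsub (Set.toFinite _)).trans
    ((Set.ncard_image_le (Set.toFinite _)).trans ?_)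
  exact le_of_eq rfl

/-- The same source value and key that witness a value at `t` also determine an intermediate value
at `v`. -/
lemma ncard_compatible_le_mul {k : Fin K} {u v t : V} {x : c.Alphabet u} {a b : ℕ}
    (ha : (c.compatible k u v x).ncard ≤ a) (hb : ∀ y, (c.compatible k v t y).ncard ≤ b) :
    (c.compatible k u t x).ncard ≤ a * b := by
  classical
  have hsub : c.compatible k u t x ⊆
      ⋃ y ∈ (c.compatible k u v x).toFinset, c.compatible k v t y := by
    rintro y ⟨s, z, hz, hz'⟩
    simp only [Set.mem_toFinset, Set.mem_iUnion]
    exact ⟨c.enc v (Pi.single k s, z), ⟨s, z, hz, rfl⟩, s, z, rfl, hz'⟩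
  refine (Set.ncard_le_ncard hsub (Set.toFinite _)).trans
    ((Finset.set_ncard_biUnion_le _ _).trans ?_)
  refine (Finset.sum_le_card_nsmul _ _ b fun y _ => hb y).trans ?_
  rw [smul_eq_mul, ← Set.ncard_eq_toFinset_card']
  exact Nat.mul_le_mul_right _ ha

end SecureStorageCode

namespace StorageGraph

variable {V : Type*} {K M : ℕ} {G : StorageGraph V K M}

lemma exists_isQualified_of_core (v : G.nonDegenerateSubgraph.qualifiedNodes) :
    ∃ u : V, ¬ G.IsDegenerate u ∧ G.IsQualified s(v.1.1, u) := by
  obtain ⟨⟨v, hv⟩, ⟨u, hu⟩, h⟩ := v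
  exact ⟨u, hu, h⟩

end StorageGraph

namespace SecureStorageCode

variable {V : Type*} {K M : ℕ} {G : StorageGraph V K M} {c : SecureStorageCode G}

/-- Each step costs one factor. The walk must stay in the core, where every node lies on a qualified
edge with non-degenerate ends and `encCard_le` applies. -/
lemma ncard_compatible_le_of_walk
    (hcommon : ∀ v : V, ¬ G.IsDegenerate v → G.commonSources v = ∅) {k : Fin K}
    {u v : G.nonDegenerateSubgraph.qualifiedNodes}
    (p : (G.core.charGraph k).unqualifiedGraph.Walk u v) (x : c.Alphabet u.1.1) :
    (c.compatible k u.1.1 v.1.1 x).ncard ≤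
      (Fintype.card c.F ^ (c.LZ - M * c.L)) ^ p.length := by
  induction p with
  | @nil u =>
    have : c.compatible k u.1.1 u.1.1 x ⊆ {x} := by
      rintro y ⟨s, z, h1, h2⟩
      exact h2.symm.trans h1
    simpa using Set.ncard_le_ncard this (Set.toFinite _)
  | @cons u v t h p ih =>
    rw [SimpleGraph.Walk.length_cons, pow_succ']
    refine ncard_compatible_le_mul ?_ ih
    obtain ⟨u', hu', hq⟩ := G.exists_isQualified_of_core u
    have hk : k ∉ G.label s(u.1.1, v.1.1) := by
      intro hk
      have h2 : (if k ∈ G.label s(u.1.1, v.1.1) then {k} else ∅ : Finset (Fin K)) = ∅ := h.2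
      simp [hk] at h2
    exact (ncard_compatible_le_of_adj (u := u.1.1) (v := v.1.1) h.1 hk x).trans
      (encCard_le hq (hcommon _ u.1.2) (hcommon _ hu') _ _)

/-- An internal qualified edge of a characteristic graph of the core forces extra key. -/
theorem L_le_length_mul (hcommon : ∀ v : V, ¬ G.IsDegenerate v → G.commonSources v = ∅)
    {k : Fin K} {u v : G.nonDegenerateSubgraph.qualifiedNodes}
    (p : (G.core.charGraph k).unqualifiedGraph.Walk u v)
    (h : (G.core.charGraph k).IsQualified s(u, v)) (c : SecureStorageCode G) :
    c.L ≤ (c.LZ - M * c.L) * p.length := by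
  classical
  have hadj : G.graph.Adj u.1.1 v.1.1 := h.1
  have hk : k ∈ G.label s(u.1.1, v.1.1) := by
    by_contra hk
    have h2 : (if k ∈ G.label s(u.1.1, v.1.1) then {k} else ∅ : Finset (Fin K)) ≠ ∅ := h.2
    simp [hk] at h2
  let x := c.enc u.1.1 (0, 0)
  -- The symbol at `u` is independent of the sources, so `x` remains possible for every value of
  -- source `k`. Decoding then makes the resulting symbols at `v` distinct.
  have hz : ∀ s, ∃ z, c.enc u.1.1 (Pi.single k s, z) = x := fun s => by
    refine fiberCard_pos_iff.1 (?_ : 0 < c.encCard u.1.1 _ x)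
    rw [encCard_eq_of_commonSources_eq_empty (hcommon _ u.1.2) _ 0]
    exact fiberCard_pos_iff.2 ⟨0, rfl⟩
  choose z hz using hz
  have hle : Fintype.card c.F ^ c.L ≤ (c.compatible k u.1.1 v.1.1 x).ncard := by
    have hinj : Function.Injective fun s : Fin c.L → c.F =>
        c.enc v.1.1 (Pi.single k s, z s) := by
      intro s s' hs
      have := decode hadj ((hz s).trans (hz s').symm) hs hk
      simpa using this
    have h1 := Set.ncard_le_ncard (s := Set.range fun s => c.enc v.1.1 (Pi.single k s, z s))
      (t := c.compatible k u.1.1 v.1.1 x) (by rintro _ ⟨s, rfl⟩; exact ⟨s, z s, hz s, rfl⟩)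
      (Set.toFinite _)
    rw [← Set.image_univ, Set.ncard_image_of_injective _ hinj, Set.ncard_univ] at h1
    simpa using h1
  refine (Nat.pow_le_pow_iff_right (Fintype.one_lt_card (α := c.F))).1 ?_
  rw [pow_mul]
  exact hle.trans (ncard_compatible_le_of_walk hcommon p x)

end SecureStorageCode

/-! ### Upper bounds on the capacity. -/

namespace StorageGraph

open scoped ENNReal

variable {V : Type*} {K M : ℕ} {G : StorageGraph V K M}

lemma sourceKeyCapacity_le {ρ : ℝ≥0∞} (h : ∀ c : SecureStorageCode G, c.rate ≤ ρ) :
    G.sourceKeyCapacity ≤ ρ := by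
  refine sSup_le ?_
  rintro R (⟨c, rfl⟩ | ⟨c, -, hc⟩)
  · exact h c
  · exact le_of_tendsto' hc fun n => h _

lemma _root_.SecureStorageCode.rate_le {c : SecureStorageCode G} {a b : ℕ} (hb : 0 < b)
    (h : b * c.L ≤ a * c.LZ) : c.rate ≤ (a : ℝ≥0∞) / b := by
  refine ENNReal.div_le_of_le_mul ?_
  rw [← ENNReal.mul_div_right_comm, ENNReal.le_div_iff_mul_le (by simp [hb.ne']) (by simp)]
  rw [mul_comm]
  exact_mod_cast h

lemma sourceKeyCapacity_le_one_div (hcore : Nonempty G.nonDegenerateSubgraph.qualifiedNodes)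
    (hcommon : ∀ v : V, ¬ G.IsDegenerate v → G.commonSources v = ∅) (hM : 0 < M) :
    G.sourceKeyCapacity ≤ 1 / (M : ℝ≥0∞) := by
  obtain ⟨v⟩ := hcore
  obtain ⟨u, hu, hq⟩ := G.exists_isQualified_of_core v
  refine sourceKeyCapacity_le fun c => ?_
  have := SecureStorageCode.rate_le (c := c) (a := 1) hM (by
    rw [one_mul]
    exact SecureStorageCode.mul_L_le_LZ hq (hcommon _ v.1.2) (hcommon _ hu))
  simpa using this

lemma sourceKeyCapacity_lt_one_div (hM : 0 < M)
    (hcommon : ∀ v : V, ¬ G.IsDegenerate v → G.commonSources v = ∅) {k : Fin K}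
    (h : (G.core.charGraph k).HasInternalQualifiedEdge) :
    G.sourceKeyCapacity < 1 / (M : ℝ≥0∞) := by
  obtain ⟨u, v, hq, ⟨p⟩⟩ := h
  obtain ⟨t, ht, hqt⟩ := G.exists_isQualified_of_core u
  -- With LZ = M L + d and n the length of the walk, L ≤ n d gives (n M + 1) L ≤ n LZ. As n does not
  -- depend on the code, the strict inequality survives the supremum.
  have hle : G.sourceKeyCapacity ≤ (p.length : ℝ≥0∞) / ((p.length * M + 1 : ℕ) : ℝ≥0∞) := by
    refine sourceKeyCapacity_le fun c => SecureStorageCode.rate_le (Nat.succ_pos _) ?_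
    have h1 := SecureStorageCode.L_le_length_mul hcommon p hq c
    obtain ⟨d, hd⟩ := Nat.exists_eq_add_of_le
      (SecureStorageCode.mul_L_le_LZ (c := c) hqt (hcommon _ u.1.2) (hcommon _ ht))
    rw [hd, Nat.add_sub_cancel_left] at h1
    rw [hd]
    nlinarith
  refine hle.trans_lt ?_
  rw [ENNReal.div_lt_iff (by simp) (by simp), one_div, mul_comm, ← div_eq_mul_inv,
    ENNReal.lt_div_iff_mul_lt (by simp [hM.ne']) (by simp)]
  exact_mod_cast Nat.lt_succ_self _

end StorageGraph

/-! ### The linear code attaining 1/M. -/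

namespace StorageGraph

variable {V : Type*} {K M : ℕ} {G : StorageGraph V K M}

/-- A node whose symbol has to be protected by key: it is not degenerate and lies on a qualified
edge whose other end is not degenerate either. -/
def IsCoreNode (G : StorageGraph V K M) (v : V) : Prop :=
  ∃ h : ¬ G.IsDegenerate v, (⟨v, h⟩ : {v : V | ¬ G.IsDegenerate v}) ∈
    G.nonDegenerateSubgraph.qualifiedNodes

/-- A core node as a node of the core. -/
def IsCoreNode.toCore {v : V} (h : G.IsCoreNode v) : G.nonDegenerateSubgraph.qualifiedNodes :=
  ⟨⟨v, h.1⟩, h.2⟩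

lemma isCoreNode_left {u v : V} (hu : ¬ G.IsDegenerate u) (hv : ¬ G.IsDegenerate v)
    (h : G.IsQualified s(u, v)) : G.IsCoreNode u :=
  ⟨hu, ⟨v, hv⟩, h⟩

/-- The colour of a component is the index of a chosen representative node; `p` is large enough for
the indices to stay distinct modulo `p`. -/
lemma exists_component_coloring [Fintype V] (G : StorageGraph V K M) {p : ℕ}
    (hp : Fintype.card V ≤ p) :
    ∃ col : Fin K → G.nonDegenerateSubgraph.qualifiedNodes → ZMod p, ∀ k u v,
      col k u = col k v ↔ (G.core.charGraph k).unqualifiedGraph.Reachable u v := by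
  classical
  let idx : V → ZMod p := fun v => ((Fintype.equivFin V v : ℕ) : ZMod p)
  have hidx : Function.Injective idx := fun u v h => by
    have h' := (ZMod.natCast_eq_natCast_iff' _ _ _).1 h
    rw [Nat.mod_eq_of_lt ((Fin.is_lt _).trans_le hp),
      Nat.mod_eq_of_lt ((Fin.is_lt _).trans_le hp)] at h'
    exact (Fintype.equivFin V).injective (Fin.ext h')
  refine ⟨fun k v => idx
    ((G.core.charGraph k).unqualifiedGraph.connectedComponentMk v).out.1.1, fun k u v => ?_⟩
  rw [hidx.eq_iff, ← Subtype.ext_iff, ← Subtype.ext_iff, ← SimpleGraph.ConnectedComponent.eq]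
  constructor
  · intro h
    rw [← Quot.out_eq ((G.core.charGraph k).unqualifiedGraph.connectedComponentMk u), h]
    exact Quot.out_eq _
  · intro h
    rw [h]

/-- The combination of the sources, with Vandermonde coefficients scaled by `col`, that is added
to the key at a node. -/
def mask {N F : Type*} [Field F] {K M : ℕ} (col : Fin K → N → F) (v : N) (w : Fin K → Fin 1 → F) :
    Fin M → F :=
  fun j => ∑ k, col k v * w k 0 * (k.1 : F) ^ j.1

/-- The symbol of a node: the common sources of a degenerate node in the clear, and the masked key
of a core node. -/
noncomputable def maskedEnc (G : StorageGraph V K M) {F : Type} [Field F]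
    (col : Fin K → G.nonDegenerateSubgraph.qualifiedNodes → F) (v : V)
    (ω : SourceSpace F K 1 M) : (Fin K → F) × (Fin M → F) :=
  open Classical in
  (fun k => if G.IsDegenerate v ∧ k ∈ G.commonSources v then ω.1 k 0 else 0,
    if h : G.IsCoreNode v then ω.2 + mask col h.toCore ω.1 else 0)

/-- Invertibility of a square Vandermonde matrix, indexed by a finite set. -/
lemma eq_zero_of_sum_mul_pow_eq_zero {F : Type*} [Field F] {ι : Type*} {S : Finset ι} {n : ℕ}
    (hS : S.card = n) {a : ι → F} (ha : Set.InjOn a S) {y : ι → F}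
    (h : ∀ j : Fin n, ∑ k ∈ S, y k * a k ^ j.1 = 0) : ∀ k ∈ S, y k = 0 := by
  let e : Fin n ≃ S := (Finset.equivFinOfCardEq hS).symm
  have := Matrix.eq_zero_of_forall_pow_sum_mul_pow_eq_zero (f := fun i => a (e i))
    (v := fun i => y (e i)) (fun i j hij => e.injective (Subtype.ext (ha (e i).2 (e j).2 hij)))
    fun j => by
      rw [← h j, ← Finset.sum_coe_sort S]
      exact Fintype.sum_equiv e _ _ fun _ => rfl
  intro k hk
  simpa using congrFun this (e.symm ⟨k, hk⟩)

lemma core_reachable_of_notMem {u v : V} (hu : G.IsCoreNode u) (hv : G.IsCoreNode v)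
    (h : G.graph.Adj u v) {k : Fin K} (hk : k ∉ G.label s(u, v)) :
    (G.core.charGraph k).unqualifiedGraph.Reachable hu.toCore hv.toCore :=
  SimpleGraph.Adj.reachable ⟨h, if_neg hk⟩

lemma core_isQualified_of_mem {u v : V} (hu : G.IsCoreNode u) (hv : G.IsCoreNode v)
    (h : G.graph.Adj u v) {k : Fin K} (hk : k ∈ G.label s(u, v)) :
    (G.core.charGraph k).IsQualified s(hu.toCore, hv.toCore) := by
  refine ⟨h, ?_⟩
  have : (G.core.charGraph k).label s(hu.toCore, hv.toCore) = {k} := if_pos hk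
  simp [this]

section Code

variable {F : Type} [Field F]
  {col : Fin K → G.nonDegenerateSubgraph.qualifiedNodes → F}

theorem maskedEnc_decode (hK : Function.Injective fun k : Fin K => (k.1 : F))
    (hcol : ∀ k u v, col k u = col k v → (G.core.charGraph k).unqualifiedGraph.Reachable u v)
    (hcol' : ∀ k u v, (G.core.charGraph k).unqualifiedGraph.Reachable u v → col k u = col k v)
    (hG : ∀ k : Fin K, ¬ (G.core.charGraph k).HasInternalQualifiedEdge) {u v : V}
    (h : G.graph.Adj u v) {ω ω' : SourceSpace F K 1 M}
    (hu : G.maskedEnc col u ω = G.maskedEnc col u ω')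
    (hv : G.maskedEnc col v ω = G.maskedEnc col v ω') {k : Fin K} (hk : k ∈ G.label s(u, v)) :
    ω.1 k = ω'.1 k := by
  classical
  simp only [maskedEnc, Prod.mk.injEq] at hu hv
  -- A degenerate endpoint stores its common sources in the clear, and these are exactly the label
  -- of the edge.
  by_cases du : G.IsDegenerate u
  · have hk' : k ∈ G.commonSources u := du v h ▸ hk
    have := congrFun hu.1 k
    simp only [du, hk', and_self, if_true] at this
    exact funext fun i => by rwa [Subsingleton.elim i 0]
  by_cases dv : G.IsDegenerate v
  · have hk' : k ∈ G.commonSources v := dv u h.symm ▸ (by rwa [Sym2.eq_swap])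
    have := congrFun hv.1 k
    simp only [dv, hk', and_self, if_true] at this
    exact funext fun i => by rwa [Subsingleton.elim i 0]
  have hq : G.IsQualified s(u, v) := ⟨h, Finset.ne_empty_of_mem hk⟩
  have cu := isCoreNode_left du dv hq
  have cv := isCoreNode_left dv du (by rwa [Sym2.eq_swap])
  have hu2 := hu.2
  have hv2 := hv.2
  simp only [cu, cv, dif_pos] at hu2 hv2
  have key := eq_zero_of_sum_mul_pow_eq_zero ((G.label_card _ hq.1).resolve_left hq.2)
    (a := fun k => (k.1 : F)) hK.injOn
    (y := fun k => (col k cu.toCore - col k cv.toCore) * (ω.1 k 0 - ω'.1 k 0)) (fun j => by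
      have e1 := congrFun hu2 j
      have e2 := congrFun hv2 j
      simp only [Pi.add_apply, mask] at e1 e2
      -- Sources outside the label have equal colours at both ends, so the sum over the label
      -- extends to all sources, where the two stored equations can be subtracted.
      rw [Finset.sum_subset (Finset.subset_univ _) fun k _ hk => by
        rw [hcol' _ _ _ (core_reachable_of_notMem cu cv h hk), sub_self, zero_mul, zero_mul]]
      have : ∑ k, (col k cu.toCore - col k cv.toCore) * (ω.1 k 0 - ω'.1 k 0) * (k.1 : F) ^ j.1 =
          (∑ k, col k cu.toCore * ω.1 k 0 * (k.1 : F) ^ j.1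
            - ∑ k, col k cu.toCore * ω'.1 k 0 * (k.1 : F) ^ j.1)
          - (∑ k, col k cv.toCore * ω.1 k 0 * (k.1 : F) ^ j.1
            - ∑ k, col k cv.toCore * ω'.1 k 0 * (k.1 : F) ^ j.1) := by
        simp only [← Finset.sum_sub_distrib]
        exact Finset.sum_congr rfl fun k _ => by ring
      rw [this]
      linear_combination e1 - e2) k hk
  -- Equal colours would connect the two ends by an unqualified path, making the edge internal for
  -- `k`.
  have hne : col k cu.toCore - col k cv.toCore ≠ 0 := fun h0 =>
    hG k ⟨_, _, core_isQualified_of_mem cu cv h hk, hcol _ _ _ (sub_eq_zero.1 h0)⟩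
  have := sub_eq_zero.1 ((mul_eq_zero.1 key).resolve_left hne)
  exact funext fun i => by rwa [Subsingleton.elim i 0]

/-- Changing sources outside the label changes the masks at two adjacent core nodes by the same
amount, since those sources have equal colours there. One translation of the key absorbs the change
at both ends. A degenerate end reveals only sources of the label, which do not change. -/
theorem exists_key_shift
    (hcol : ∀ k u v, (G.core.charGraph k).unqualifiedGraph.Reachable u v → col k u = col k v)
    {u v : V} (h : G.graph.Adj u v) {w w' : Fin K → Fin 1 → F}
    (hw : ∀ k ∈ G.label s(u, v), w k = w' k) :
    ∃ d : Fin M → F, ∀ z, G.maskedEnc col u (w, z) = G.maskedEnc col u (w', z + d) ∧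
      G.maskedEnc col v (w, z) = G.maskedEnc col v (w', z + d) := by
  classical
  have hfst : ∀ {u v : V}, G.graph.Adj u v → (∀ k ∈ G.label s(u, v), w k = w' k) → ∀ z z',
      (G.maskedEnc col u (w, z)).1 = (G.maskedEnc col u (w', z')).1 := by
    intro u v h hw z z'
    funext k
    simp only [maskedEnc]
    split_ifs with hk
    · rw [hw k (hk.1 v h ▸ hk.2)]
    · rfl
  have hv' := hfst h.symm (by rwa [Sym2.eq_swap])
  have hsnd : ∀ (u : V) (d : Fin M → F),
      (∀ c : G.IsCoreNode u, d = mask col c.toCore w - mask col c.toCore w') → ∀ z,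
      (G.maskedEnc col u (w, z)).2 = (G.maskedEnc col u (w', z + d)).2 := by
    intro u d hd z
    by_cases c : G.IsCoreNode u
    · simp only [maskedEnc, c, dif_pos, hd c]
      abel
    · simp only [maskedEnc, c, dif_neg, not_false_eq_true]
  suffices hd : ∃ d : Fin M → F,
      (∀ c : G.IsCoreNode u, d = mask col c.toCore w - mask col c.toCore w') ∧
      (∀ c : G.IsCoreNode v, d = mask col c.toCore w - mask col c.toCore w') by
    obtain ⟨d, h1, h2⟩ := hd
    exact ⟨d, fun z => ⟨Prod.ext (hfst h hw _ _) (hsnd u d h1 z),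
      Prod.ext (hv' _ _) (hsnd v d h2 z)⟩⟩
  by_cases cu : G.IsCoreNode u
  · refine ⟨mask col cu.toCore w - mask col cu.toCore w', fun _ => rfl, fun cv => ?_⟩
    funext j
    simp only [mask, Pi.sub_apply, ← Finset.sum_sub_distrib]
    refine Finset.sum_congr rfl fun k _ => ?_
    by_cases hk : k ∈ G.label s(u, v)
    · simp [hw k hk]
    · rw [hcol _ _ _ (core_reachable_of_notMem cu cv h hk)]
  · by_cases cv : G.IsCoreNode v
    · exact ⟨mask col cv.toCore w - mask col cv.toCore w', fun c => absurd c cu, fun _ => rfl⟩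
    · exact ⟨0, fun c => absurd c cu, fun c => absurd c cv⟩

end Code

theorem exists_code_of_no_internal [Fintype V]
    (hG : ∀ k : Fin K, ¬ (G.core.charGraph k).HasInternalQualifiedEdge) :
    ∃ c : SecureStorageCode G, c.L = 1 ∧ c.LZ = M := by
  classical
  -- The field must contain `K` distinct Vandermonde nodes and a distinct index for every node of
  -- the graph; any prime `p ≥ K + |V|` provides both.
  obtain ⟨p, hp, hprime⟩ := Nat.exists_infinite_primes (K + Fintype.card V)
  have : Fact p.Prime := ⟨hprime⟩
  obtain ⟨col, hcol⟩ := G.exists_component_coloring (p := p) (by omega)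
  have hK : Function.Injective fun k : Fin K => (k.1 : ZMod p) := fun k l hkl => by
    have h' := (ZMod.natCast_eq_natCast_iff' _ _ _).1 hkl
    rw [Nat.mod_eq_of_lt (by omega), Nat.mod_eq_of_lt (by omega)] at h'
    exact Fin.ext h'
  refine ⟨{ F := ZMod p, L := 1, LZ := M, L_pos := one_pos,
            Alphabet := fun _ => (Fin K → ZMod p) × (Fin M → ZMod p),
            enc := G.maskedEnc col, correctness := ?_, security := ?_ }, rfl, rfl⟩
  · intro u v h
    rw [condEntropy_eq_zero_iff Fintype.one_lt_card]
    intro ω ω' hω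
    rw [Prod.mk.injEq] at hω
    exact funext fun k =>
      maskedEnc_decode hK (fun k u v => (hcol k u v).1) (fun k u v => (hcol k u v).2) hG h hω.1 hω.2 k.2
  · intro u v h
    rw [condMutualInfo_sources_eq_zero_iff]
    intro x w w' hw
    obtain ⟨d, hd⟩ := exists_key_shift (fun k u v => (hcol k u v).2) h hw
    -- Translation by `d` is a bijection between the keys giving `x` under `w` and those giving `x`
    -- under `w'`.
    refine Nat.card_congr ((Equiv.addRight d).subtypeEquiv fun z => ?_)
    simp only [Equiv.coe_addRight, (hd z).1, (hd z).2]

end StorageGraph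

theorem theorem2 {V : Type*} [Fintype V] {K M : ℕ} (G : StorageGraph V K M)
    (hcore : Nonempty G.nonDegenerateSubgraph.qualifiedNodes)
    (hcommon : ∀ v : V, ¬ G.IsDegenerate v → G.commonSources v = ∅) :
    G.sourceKeyCapacity = 1 / (M : ENNReal) ↔
      ∀ k : Fin K, ¬ (G.core.charGraph k).HasInternalQualifiedEdge := by
  have hM : 0 < M := by
    obtain ⟨v⟩ := hcore
    obtain ⟨u, -, hq⟩ := G.exists_isQualified_of_core v
    rw [← (G.label_card _ hq.1).resolve_left hq.2, Finset.card_pos, Finset.nonempty_iff_ne_empty]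
    exact hq.2
  constructor
  · intro h k hk
    exact (StorageGraph.sourceKeyCapacity_lt_one_div hM hcommon hk).ne h
  · intro h
    refine le_antisymm (StorageGraph.sourceKeyCapacity_le_one_div hcore hcommon hM) ?_
    obtain ⟨c, hL, hLZ⟩ := StorageGraph.exists_code_of_no_internal h
    refine le_sSup (Or.inl ⟨c, ?_⟩)
    rw [SecureStorageCode.rate, hL, hLZ, Nat.cast_one]
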